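/- Let $p>3$ be a prime, let $\mathbb Z_p$ be the ring of $p$-adic integers, and let $a\in\mathbb Z_p$ with $a\not\equiv 0\pmod p$. Let $\langle a\rangle_p\in\{0,1,\ldots,p-1\}$ be the integer with $a\equiv\langle a\rangle_p\pmod p$, and put $t=(a-\langle a\rangle_p)/p$. Write $\binom ak=a(a-1)\cdots(a-k+1)/k!$. Let $B_n$ be the Bernoulli numbers, defined by $B_0=1$ and $\sum_{k=0}^{n-1}\binom nkB_k=0$ for $n\ge 2$, and let $B_n(x)=\sum_{k=0}^n\binom nkB_kx^{n-k}$ be the Bernoulli polynomials. Then $$\sum_{k=1}^{p-1}\frac{\binom ak\binom{-1-a}k}{k}\equiv-\frac23\,p^2t(t+1)B_{p-3}(-a)-2\,\frac{B_{p^2(p-1)}(-a)-B_{p^2(p-1)}}{p^2(p-1)}\pmod{p^3},$$ where, for $x,y\in\mathbb Q_p$, $x\equiv y\pmod{p^3}$ means $x-y\in p^3\mathbb Z_p$. -/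

import Mathlib

/-- Congruence modulo `p ^ n` between `p`-adic numbers: `x` and `y` are congruent when
`x - y` lies in `p ^ n ℤ_p`. -/
def PadicModEq (p : ℕ) [Fact p.Prime] (n : ℕ) (x y : ℚ_[p]) : Prop :=
  ∃ c : ℤ_[p], x - y = (p : ℚ_[p]) ^ n * (c : ℚ_[p])

/-- The value at a `p`-adic number `x` of the `n`-th Bernoulli polynomial
`B_n(X) = ∑ k ≤ n, C(n, k) B_k X ^ (n - k)`. -/
noncomputable def bernoulliPolyVal (p : ℕ) [Fact p.Prime] (n : ℕ) (x : ℚ_[p]) : ℚ_[p] :=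
  Polynomial.aeval x (Polynomial.bernoulli n)

open Finset

/-! ### Congruences modulo powers of `p` in `ℚ_p`. -/

section Ideals

variable {p : ℕ} [Fact p.Prime]

/-! Write S(a) for the sum (`chooseSum`) and M = p²(p-1) = φ(p³). Since S is invariant under a ↦
-1-a, the difference a(S(a) - S(a-1)) telescopes to 2(∏(1 - a²/j²) - 1) (`mul_chooseSum_sub`). For a
unit a = pt+i, Wilson's theorem gives a²∏ ≡ p²t(t+1) mod p³ (`sq_mul_sineProd_mem`), so S(a) -
S(a-1) ≡ -2/a + 2p²t(t+1)/a³. By Euler, 1/a becomes a^(M-1) mod p³ and 1/a³ becomes a^(p-4) mod p.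
Descending from a to pt thus yields power sums, which are increments of B_M and B_(p-3).

At pt itself, S(pt) ≡ -p²t B_(M-2) (`chooseSum_p_mul_mem`, `sum_range_pow_sub_p_mul_mem`), and
(B_M(pt) - B_M)/M ≡ (M-1)/2 · p²t² B_(M-2) (`bernoulliPolyVal_p_mul_sub_div_mem`). The two sides
match by the Kummer congruence 3B_(M-2) ≡ 2B_(p-3) mod p (`three_mul_padicBernoulli_sub_mem`), a
consequence of Voronoi's congruence with multiplier 2. -/

/-- The additive subgroup `p ^ n ℤ_p` of `ℚ_p`. -/
def padicIdeal (p : ℕ) [Fact p.Prime] (n : ℕ) : AddSubgroup ℚ_[p] where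
  carrier := {x | ∃ c : ℤ_[p], x = (p : ℚ_[p]) ^ n * (c : ℚ_[p])}
  zero_mem' := ⟨0, by simp⟩
  add_mem' := by
    rintro _ _ ⟨c, rfl⟩ ⟨d, rfl⟩
    exact ⟨c + d, by push_cast; ring⟩
  neg_mem' := by
    rintro _ ⟨c, rfl⟩
    exact ⟨-c, by push_cast; ring⟩

theorem mem_padicIdeal {n : ℕ} {x : ℚ_[p]} :
    x ∈ padicIdeal p n ↔ ∃ c : ℤ_[p], x = (p : ℚ_[p]) ^ n * (c : ℚ_[p]) := Iff.rfl

theorem padicModEq_iff {n : ℕ} {x y : ℚ_[p]} : PadicModEq p n x y ↔ x - y ∈ padicIdeal p n :=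
  Iff.rfl

namespace padicIdeal

theorem of_eq {n : ℕ} {x y : ℚ_[p]} (h : x ∈ padicIdeal p n) (e : y = x) : y ∈ padicIdeal p n :=
  e ▸ h

theorem p_ne_zero : (p : ℚ_[p]) ≠ 0 := by
  exact_mod_cast (Fact.out : p.Prime).ne_zero

theorem coe_mem (c : ℤ_[p]) : (c : ℚ_[p]) ∈ padicIdeal p 0 := ⟨c, by simp⟩

theorem natCast_mem (c : ℕ) : (c : ℚ_[p]) ∈ padicIdeal p 0 := by
  simpa using coe_mem (c : ℤ_[p])

theorem intCast_mem (c : ℤ) : (c : ℚ_[p]) ∈ padicIdeal p 0 := by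
  simpa using coe_mem (c : ℤ_[p])

theorem mul {m n : ℕ} {x y : ℚ_[p]} (hx : x ∈ padicIdeal p m) (hy : y ∈ padicIdeal p n) :
    x * y ∈ padicIdeal p (m + n) := by
  obtain ⟨c, rfl⟩ := hx
  obtain ⟨d, rfl⟩ := hy
  exact ⟨c * d, by push_cast; ring⟩

theorem le {m n : ℕ} (h : n ≤ m) : padicIdeal p m ≤ padicIdeal p n := by
  rintro _ ⟨c, rfl⟩
  obtain ⟨k, rfl⟩ := Nat.exists_eq_add_of_le h
  exact ⟨p ^ k * c, by push_cast; ring⟩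

theorem int_mul {n : ℕ} {x y : ℚ_[p]} (hx : x ∈ padicIdeal p 0) (hy : y ∈ padicIdeal p n) :
    x * y ∈ padicIdeal p n := by
  simpa using mul hx hy

theorem mul_int {n : ℕ} {x y : ℚ_[p]} (hx : x ∈ padicIdeal p n) (hy : y ∈ padicIdeal p 0) :
    x * y ∈ padicIdeal p n := mul hx hy

theorem pow_mem (n : ℕ) : (p : ℚ_[p]) ^ n ∈ padicIdeal p n := ⟨1, by simp⟩

theorem p_mem : (p : ℚ_[p]) ∈ padicIdeal p 1 := ⟨1, by simp⟩

theorem int_pow {x : ℚ_[p]} (hx : x ∈ padicIdeal p 0) (n : ℕ) : x ^ n ∈ padicIdeal p 0 := by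
  obtain ⟨c, rfl⟩ := hx
  exact ⟨c ^ n, by simp⟩

theorem p_mul_iff {n : ℕ} {x : ℚ_[p]} : p * x ∈ padicIdeal p (n + 1) ↔ x ∈ padicIdeal p n := by
  constructor
  · rintro ⟨c, hc⟩
    refine ⟨c, mul_left_cancel₀ p_ne_zero ?_⟩
    rw [hc]; ring
  · intro h
    simpa [add_comm] using mul p_mem h

theorem coe_mem_iff {n : ℕ} {c : ℤ_[p]} : (c : ℚ_[p]) ∈ padicIdeal p n ↔ (p : ℤ_[p]) ^ n ∣ c := by
  constructor
  · rintro ⟨d, hd⟩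
    exact ⟨d, by apply PadicInt.ext; simpa using hd⟩
  · rintro ⟨d, rfl⟩
    exact ⟨d, by simp⟩

theorem inv_mem {c : ℤ_[p]} (h : ¬ (p : ℤ_[p]) ∣ c) : ((c : ℚ_[p]))⁻¹ ∈ padicIdeal p 0 := by
  have h1 : ‖c‖ = 1 := by
    rw [← PadicInt.norm_lt_one_iff_dvd] at h
    exact le_antisymm (PadicInt.norm_le_one c) (not_lt.1 h)
  refine ⟨c.inv, ?_⟩
  have h2 : (c : ℚ_[p]) * (c.inv : ℚ_[p]) = 1 := by
    exact_mod_cast congrArg (fun z : ℤ_[p] => (z : ℚ_[p])) (PadicInt.mul_inv h1)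
  rw [pow_zero, one_mul]
  exact (eq_inv_of_mul_eq_one_right h2).symm

theorem natCast_dvd_iff {k : ℕ} : (p : ℤ_[p]) ∣ (k : ℤ_[p]) ↔ p ∣ k := by
  rw [← PadicInt.norm_lt_one_iff_dvd, PadicInt.norm_natCast_lt_one_iff]

theorem natCast_inv_mem {k : ℕ} (h : ¬ p ∣ k) : ((k : ℚ_[p]))⁻¹ ∈ padicIdeal p 0 := by
  simpa using inv_mem (c := (k : ℤ_[p])) (mt natCast_dvd_iff.1 h)

theorem natCast_succ_inv_mem {k : ℕ} (h : k < p - 1) :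
    ((k : ℚ_[p]) + 1)⁻¹ ∈ padicIdeal p 0 := by
  have := natCast_inv_mem (p := p) (k := k + 1) (Nat.not_dvd_of_pos_of_lt (by omega) (by omega))
  exact_mod_cast this

/-- A unit may be cancelled. -/
theorem of_natCast_mul {n k : ℕ} {x : ℚ_[p]} (h : ¬ p ∣ k) (hx : k * x ∈ padicIdeal p n) :
    x ∈ padicIdeal p n := by
  have hk : (k : ℚ_[p]) ≠ 0 := by
    intro h0
    exact h (by rw [Nat.cast_eq_zero.1 h0]; exact dvd_zero p)
  have := int_mul (natCast_inv_mem h) hx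
  rwa [inv_mul_cancel_left₀ hk] at this

/-- If p^v exactly divides m, then m ≥ 5^v ≥ 4v+1, so v ≤ (m-1)/4. This absorbs the denominators of
the expansions below. -/
theorem pow_div_mem (hp : 3 < p) {e f m : ℕ} (hm : m ≠ 0) (h : (m - 1) / 4 + f ≤ e) :
    (p : ℚ_[p]) ^ e / m ∈ padicIdeal p f := by
  obtain ⟨v, u, hu, rfl⟩ := Nat.exists_eq_pow_mul_and_not_dvd hm p (Fact.out : p.Prime).ne_one
  have hp4 : p ≠ 4 := by
    rintro rfl
    exact absurd (Fact.out : Nat.Prime 4) (by decide)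
  have hv : 4 * v + 1 ≤ p ^ v * u := by
    have h1 : 4 * v + 1 ≤ 5 ^ v := by
      induction v with
      | zero => simp
      | succ v ih =>
        have : p ^ v * u ≠ 0 := by
          intro h0
          apply hm
          rw [pow_succ, mul_right_comm, h0, zero_mul]
        have hle : (p ^ v * u - 1) / 4 + f ≤ e := by
          refine le_trans ?_ h
          gcongr
          · exact (Fact.out : p.Prime).one_le
          · omega
        have := ih this hle
        rw [pow_succ]; omega
    have h2 : 5 ^ v ≤ p ^ v := Nat.pow_le_pow_left (by omega) v
    have h3 : 0 < u := Nat.pos_of_ne_zero (by rintro rfl; simp at hm)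
    nlinarith [Nat.le_mul_of_pos_right (p ^ v) h3]
  have hve : v + f ≤ e := by omega
  obtain ⟨d, rfl⟩ := Nat.exists_eq_add_of_le hve
  have : (p : ℚ_[p]) ^ (v + f + d) / ((p ^ v * u : ℕ) : ℚ_[p]) =
      (p : ℚ_[p]) ^ (f + d) * (u : ℚ_[p])⁻¹ := by
    have := p_ne_zero (p := p)
    push_cast
    rw [div_eq_mul_inv, mul_inv, ← mul_assoc]
    congr 1
    field_simp
    ring
  rw [this]
  exact mul_int (le (by omega) (pow_mem (f + d))) (natCast_inv_mem hu)

theorem pow_sub_one_mem {c : ℤ_[p]} (h : ¬ (p : ℤ_[p]) ∣ c) (k : ℕ) :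
    (c : ℚ_[p]) ^ (p ^ k * (p - 1)) - 1 ∈ padicIdeal p (k + 1) := by
  have h1 : (p : ℤ_[p]) ∣ c ^ (p - 1) - 1 := by
    rw [← Ideal.mem_span_singleton, ← PadicInt.maximalIdeal_eq_span_p, ← PadicInt.ker_toZMod,
      RingHom.mem_ker, map_sub, map_pow, map_one, sub_eq_zero]
    apply ZMod.pow_card_sub_one_eq_one
    rwa [Ne, ← RingHom.mem_ker, PadicInt.ker_toZMod, PadicInt.maximalIdeal_eq_span_p,
      Ideal.mem_span_singleton]
  have h2 := dvd_sub_pow_of_dvd_sub h1 k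
  rw [one_pow, ← pow_mul, mul_comm (p - 1)] at h2
  have := coe_mem_iff.2 h2
  simpa using this

attribute [irreducible] padicIdeal

end padicIdeal

end Ideals

/-! ### Power sums and Bernoulli numbers modulo powers of `p`. -/

section BernoulliCongruences

variable {p : ℕ} [Fact p.Prime]

/-- The `n`-th Bernoulli number as a `p`-adic number. -/
noncomputable def padicBernoulli (p : ℕ) [Fact p.Prime] (n : ℕ) : ℚ_[p] :=
  ((bernoulli n : ℚ) : ℚ_[p])

theorem padicBernoulli_of_odd {n : ℕ} (h : Odd n) (h1 : 1 < n) : padicBernoulli p n = 0 := by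
  simp [padicBernoulli, bernoulli_eq_zero_of_odd h h1]

theorem sum_range_pow_padic (n : ℕ) :
    ∑ j ∈ range p, (j : ℚ_[p]) ^ n =
      ∑ k ∈ range (n + 1), padicBernoulli p (n - k) * n.choose k * p ^ (k + 1) / (k + 1 : ℕ) := by
  have h := congrArg (fun q : ℚ => (q : ℚ_[p])) (sum_range_pow p n)
  push_cast at h
  rw [h, ← sum_range_reflect]
  refine sum_congr rfl fun k hk => ?_
  have hk : k ≤ n := Nat.lt_succ_iff.1 (mem_range.1 hk)
  have e1 : n + 1 - 1 - k = n - k := by omega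
  have e2 : n + 1 - (n - k) = k + 1 := by omega
  have e3 : (n + 1).choose (n - k) = (n + 1).choose (k + 1) := by
    rw [← Nat.choose_symm (by omega : k + 1 ≤ n + 1)]
    congr 1; omega
  have e4 : ((n : ℚ_[p]) + 1) * n.choose k = (n + 1).choose (k + 1) * (k + 1) := by
    exact_mod_cast Nat.add_one_mul_choose_eq n k
  have h1 : (n : ℚ_[p]) + 1 ≠ 0 := by exact_mod_cast n.succ_ne_zero
  have h2 : (k : ℚ_[p]) + 1 ≠ 0 := by exact_mod_cast k.succ_ne_zero
  rw [e1, e2, e3, padicBernoulli]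
  push_cast
  rw [div_eq_div_iff h1 h2]
  linear_combination (-((bernoulli (n - k) : ℚ) : ℚ_[p]) * p ^ (k + 1)) * e4

theorem sum_range_pow_sub_padicBernoulli (n : ℕ) :
    ∑ j ∈ range p, (j : ℚ_[p]) ^ n - p * padicBernoulli p n =
      ∑ k ∈ range n, p * padicBernoulli p (n - (k + 1)) * n.choose (k + 1) *
        (p ^ (k + 1) / (k + 2 : ℕ)) := by
  rw [sum_range_pow_padic, sum_range_succ']
  simp only [Nat.sub_zero, Nat.choose_zero_right, Nat.cast_one, zero_add, pow_one, mul_one, div_one]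
  rw [mul_comm (p : ℚ_[p]) (padicBernoulli p n), add_sub_cancel_right]
  refine sum_congr rfl fun k _ => ?_
  rw [pow_succ (p : ℚ_[p]) (k + 1)]
  ring

open padicIdeal

theorem sum_natCast_pow_mem (n m : ℕ) : ∑ j ∈ range m, (j : ℚ_[p]) ^ n ∈ padicIdeal p 0 := by
  simpa using natCast_mem (∑ j ∈ range m, j ^ n)

/-- Weak von Staudt–Clausen: the power sum is an integer, and by induction every term of Faulhaber's
formula other than pB_n is integral. -/
theorem p_mul_padicBernoulli_mem (hp : 3 < p) (n : ℕ) :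
    p * padicBernoulli p n ∈ padicIdeal p 0 := by
  induction n using Nat.strong_induction_on with
  | _ n ih =>
    have h := sum_range_pow_sub_padicBernoulli (p := p) n
    have h' := sub_eq_iff_eq_add.1 h
    rw [← sub_eq_iff_eq_add'.2 h']
    refine sub_mem (sum_natCast_pow_mem n p) (sum_mem fun k hk => ?_)
    have hk := mem_range.1 hk
    exact int_mul (int_mul (ih _ (by omega)) (natCast_mem _))
      (pow_div_mem hp (by omega) (by omega))

theorem padicBernoulli_one_mem (hp : 3 < p) : padicBernoulli p 1 ∈ padicIdeal p 0 := by
  apply of_natCast_mul (k := 2) (Nat.not_dvd_of_pos_of_lt (by omega) (by omega))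
  have : ((2 : ℕ) : ℚ_[p]) * padicBernoulli p 1 = ((-1 : ℤ) : ℚ_[p]) := by
    simp only [padicBernoulli, bernoulli_one]
    push_cast
    norm_num
  rw [this]
  exact intCast_mem _

theorem padicBernoulli_mem_of_odd (hp : 3 < p) {n : ℕ} (h : Odd n) :
    padicBernoulli p n ∈ padicIdeal p 0 := by
  rcases eq_or_ne n 1 with rfl | h1
  · exact padicBernoulli_one_mem hp
  · rw [padicBernoulli_of_odd h (by have := h.pos; omega)]
    exact zero_mem _

/-- Power sums of even exponent agree with `p B_n` modulo `p ^ 2`. -/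
theorem sum_range_pow_sub_p_mul_mem (hp : 3 < p) {n : ℕ} (hn : Even n) :
    ∑ j ∈ range p, (j : ℚ_[p]) ^ n - p * padicBernoulli p n ∈ padicIdeal p 2 := by
  rw [sum_range_pow_sub_padicBernoulli]
  refine sum_mem fun k hk => ?_
  have hk := mem_range.1 hk
  rcases Nat.eq_zero_or_pos k with rfl | hk0
  -- Here p^(k+1)/(k+2) supplies only one factor p; the index is odd, so B_(n-1) itself is integral
  -- and the spare p remains.
  · have h1 : padicBernoulli p (n - (0 + 1)) ∈ padicIdeal p 0 :=
      padicBernoulli_mem_of_odd hp (by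
        obtain ⟨m, rfl⟩ := hn
        exact ⟨m - 1, by omega⟩)
    have h2 := mul (mul_int (mul_int p_mem h1) (natCast_mem (n.choose (0 + 1))))
      (pow_div_mem hp (e := 1) (f := 1) (m := 2) (by omega) (by omega))
    simpa using h2
  · exact int_mul (int_mul (p_mul_padicBernoulli_mem hp _) (natCast_mem _))
      (pow_div_mem hp (by omega) (by omega))

/-! ### Bernoulli polynomials: reflection, translation, expansion at multiples of `p`. -/

theorem bernoulliPolyVal_eq (n : ℕ) (x : ℚ_[p]) :
    bernoulliPolyVal p n x = ∑ k ∈ range (n + 1), padicBernoulli p (n - k) * n.choose k * x ^ k := by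
  rw [bernoulliPolyVal, Polynomial.bernoulli_def, map_sum]
  refine sum_congr rfl fun k _ => ?_
  rw [Polynomial.aeval_monomial, padicBernoulli]
  simp

theorem bernoulliPolyVal_sub (n : ℕ) (x : ℚ_[p]) :
    bernoulliPolyVal p n x - padicBernoulli p n =
      ∑ k ∈ range n, padicBernoulli p (n - (k + 1)) * n.choose (k + 1) * x ^ (k + 1) := by
  rw [bernoulliPolyVal_eq, sum_range_succ']
  simp

theorem bernoulliPolyVal_one_add (n : ℕ) (x : ℚ_[p]) :
    bernoulliPolyVal p n (1 + x) = bernoulliPolyVal p n x + n * x ^ (n - 1) := by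
  have := congrArg (Polynomial.aeval x) (Polynomial.bernoulli_comp_one_add_X n)
  simpa [Polynomial.aeval_comp, bernoulliPolyVal] using this

theorem bernoulliPolyVal_neg_of_even {n : ℕ} (hn : Even n) (x : ℚ_[p]) :
    bernoulliPolyVal p n (-x) = bernoulliPolyVal p n x + n * x ^ (n - 1) := by
  have := congrArg (Polynomial.aeval x) (Polynomial.bernoulli_comp_neg_X n)
  simpa [Polynomial.aeval_comp, bernoulliPolyVal, hn.neg_one_pow] using this

theorem bernoulliPolyVal_add_natCast (n r : ℕ) (x : ℚ_[p]) :
    bernoulliPolyVal p n (x + r) =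
      bernoulliPolyVal p n x + n * ∑ i ∈ range r, (x + i) ^ (n - 1) := by
  induction r with
  | zero => simp
  | succ r ih =>
    rw [sum_range_succ, Nat.cast_succ, show x + (r + 1 : ℚ_[p]) = 1 + (x + r) by ring,
      bernoulliPolyVal_one_add, ih]
    ring

theorem bernoulliPolyVal_neg_add_natCast {n : ℕ} (hn : Even n) (r : ℕ) (x : ℚ_[p]) :
    bernoulliPolyVal p n (-(x + r)) =
      bernoulliPolyVal p n x + n * x ^ (n - 1) +
        n * ∑ i ∈ range r, (x + (i + 1 : ℕ)) ^ (n - 1) := by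
  rw [bernoulliPolyVal_neg_of_even hn, add_assoc, ← mul_add, add_comm (x ^ (n - 1)),
    show x ^ (n - 1) = (x + (0 : ℕ)) ^ (n - 1) by simp,
    ← sum_range_succ' (fun i : ℕ => (x + (i : ℚ_[p])) ^ (n - 1)),
    bernoulliPolyVal_add_natCast, sum_range_succ]
  ring

theorem bernoulliPolyVal_p_mul_sub_mem (hp : 3 < p) {n : ℕ} (hn : Even n) {t : ℚ_[p]}
    (ht : t ∈ padicIdeal p 0) :
    bernoulliPolyVal p n (p * t) - padicBernoulli p n ∈ padicIdeal p 1 := by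
  rw [bernoulliPolyVal_sub]
  refine sum_mem fun k hk => ?_
  have hk := mem_range.1 hk
  rw [mul_pow, ← mul_assoc]
  refine mul_int ?_ (int_pow ht _)
  rcases Nat.eq_zero_or_pos k with rfl | hk0
  · have h1 : padicBernoulli p (n - (0 + 1)) ∈ padicIdeal p 0 :=
      padicBernoulli_mem_of_odd hp (by
        obtain ⟨m, rfl⟩ := hn
        exact ⟨m - 1, by omega⟩)
    simpa using int_mul (mul_int h1 (natCast_mem (n.choose (0 + 1)))) p_mem
  · have h := int_mul (int_mul (p_mul_padicBernoulli_mem hp (n - (k + 1)))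
      (natCast_mem (n.choose (k + 1)))) (le hk0 (pow_mem (p := p) k))
    refine of_eq h ?_
    ring

/-- Second order expansion of `B_n(p t) / n` for even `n`. -/
theorem bernoulliPolyVal_p_mul_sub_div_mem (hp : 3 < p) {n : ℕ} (hn : Even n) (h4 : 4 < n)
    {t : ℚ_[p]} (ht : t ∈ padicIdeal p 0) :
    (bernoulliPolyVal p n (p * t) - padicBernoulli p n) / n -
      (n - 1) / 2 * padicBernoulli p (n - 2) * (p * t) ^ 2 ∈ padicIdeal p 3 := by
  have hn0 : (n : ℚ_[p]) ≠ 0 := by exact_mod_cast (by omega : n ≠ 0)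
  obtain ⟨m, rfl⟩ : ∃ m, n = m + 3 := ⟨n - 3, by omega⟩
  have hodd1 : Odd (m + 3 - 1) := by
    obtain ⟨l, hl⟩ := hn
    exact ⟨l - 1, by omega⟩
  have hodd3 : Odd m := by
    obtain ⟨l, hl⟩ := hn
    exact ⟨l - 2, by omega⟩
  -- C(n,k+1)/n = C(n-1,k)/(k+1) removes the division by n, which would cost p² when n = p²(p-1).
  have hterm : ∀ k : ℕ, padicBernoulli p (m + 3 - (k + 1)) * (m + 3).choose (k + 1) *
      (p * t) ^ (k + 1) / (m + 3 : ℕ) = padicBernoulli p (m + 3 - (k + 1)) * (m + 2).choose k *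
      (p * t) ^ (k + 1) / (k + 1 : ℕ) := by
    intro k
    have e4 : ((m + 3 : ℕ) : ℚ_[p]) * (m + 2).choose k =
        (m + 3).choose (k + 1) * (k + 1 : ℕ) := by
      exact_mod_cast Nat.add_one_mul_choose_eq (m + 2) k
    have h2 : ((k + 1 : ℕ) : ℚ_[p]) ≠ 0 := by exact_mod_cast k.succ_ne_zero
    rw [div_eq_div_iff hn0 h2]
    linear_combination (-(padicBernoulli p (m + 3 - (k + 1))) * (p * t) ^ (k + 1)) * e4
  rw [bernoulliPolyVal_sub, sum_div, sum_congr rfl fun k _ => hterm k, sum_range_succ',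
    sum_range_succ', sum_range_succ']
  -- The linear and cubic terms have odd Bernoulli index above 1 (hence n > 4) and vanish.
  rw [show m + 3 - (0 + 1 + 1 + 1) = m by omega, show m + 3 - (0 + 1) = m + 3 - 1 by omega,
    padicBernoulli_of_odd hodd1 (by omega), padicBernoulli_of_odd hodd3 (by omega)]
  have e : ∀ s : ℚ_[p], s + 0 * ((m + 2).choose (0 + 1 + 1) : ℚ_[p]) * (p * t) ^ (0 + 1 + 1 + 1) /
      ((0 + 1 + 1 + 1 : ℕ) : ℚ_[p]) + padicBernoulli p (m + 3 - (0 + 1 + 1)) *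
      ((m + 2).choose (0 + 1) : ℚ_[p]) * (p * t) ^ (0 + 1 + 1) / ((0 + 1 + 1 : ℕ) : ℚ_[p]) +
      0 * ((m + 2).choose 0 : ℚ_[p]) * (p * t) ^ (0 + 1) / ((0 + 1 : ℕ) : ℚ_[p]) -
      (((m + 3 : ℕ) : ℚ_[p]) - 1) / 2 * padicBernoulli p (m + 3 - 2) * (p * t) ^ 2 = s := by
    intro s
    simp
    ring
  rw [e]
  refine sum_mem fun k _ => ?_
  have h := int_mul (mul_int (int_mul (p_mul_padicBernoulli_mem hp (m + 3 - (k + 1 + 1 + 1 + 1)))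
    (natCast_mem ((m + 2).choose (k + 1 + 1 + 1)))) (int_pow ht (k + 1 + 1 + 1 + 1)))
    (pow_div_mem hp (e := k + 3) (f := 3) (m := k + 1 + 1 + 1 + 1) (by omega) (by omega))
  refine of_eq h ?_
  ring

/-! ### Voronoi's congruence and the Kummer congruence. -/

/-- Summing `n`-th powers over the doubles of `0, …, 2h`. -/
theorem two_pow_mul_sum_pow {R : Type*} [CommRing R] (n h : ℕ) :
    2 ^ n * ∑ j ∈ range (2 * h + 1), (j : R) ^ n - ∑ j ∈ range (2 * h + 1), (j : R) ^ n =
      ∑ j ∈ range h, (((2 * h + 1 : ℕ) + (2 * j + 1 : ℕ) : R) ^ n - ((2 * j + 1 : ℕ) : R) ^ n) := by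
  have h1 : ∀ g : ℕ, ∑ j ∈ range (2 * g + 1), (j : R) ^ n =
      ∑ j ∈ range (g + 1), (2 * j : R) ^ n + ∑ j ∈ range g, ((2 * j + 1 : ℕ) : R) ^ n := by
    intro g
    induction g with
    | zero => simp
    | succ g ih =>
      rw [show 2 * (g + 1) + 1 = 2 * g + 1 + 1 + 1 by ring, sum_range_succ, sum_range_succ, ih,
        sum_range_succ _ (g + 1),
        sum_range_succ (fun j : ℕ => ((2 * j + 1 : ℕ) : R) ^ n) g]
      push_cast
      ring
  -- The doubles of 0,…,h are the even numbers up to 2h; those of h+1,…,2h are 2h+1 plus the odd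
  -- numbers below 2h.
  have h2 : 2 ^ n * ∑ j ∈ range (2 * h + 1), (j : R) ^ n =
      ∑ j ∈ range (h + 1), (2 * j : R) ^ n +
        ∑ j ∈ range h, ((2 * h + 1 : ℕ) + (2 * j + 1 : ℕ) : R) ^ n := by
    rw [mul_sum, show 2 * h + 1 = h + 1 + h by ring, sum_range_add]
    congr 1
    · exact sum_congr rfl fun j _ => by rw [mul_pow]
    · refine sum_congr rfl fun j _ => ?_
      rw [← mul_pow]
      push_cast
      ring
  rw [h2, h1 h, sum_sub_distrib]
  ring

theorem add_pow_sub_sub_mem {x : ℚ_[p]} (hx : x ∈ padicIdeal p 0) (n : ℕ) :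
    (p + x) ^ n - x ^ n - n * p * x ^ (n - 1) ∈ padicIdeal p 2 := by
  obtain ⟨c, hc⟩ := mem_padicIdeal.1 hx
  obtain ⟨k, hk⟩ := Polynomial.powAddExpansion c (p : ℤ_[p]) n
  have h := congrArg (fun z : ℤ_[p] => (z : ℚ_[p])) hk
  rw [pow_zero, one_mul] at hc
  push_cast at h
  refine mem_padicIdeal.2 ⟨k, ?_⟩
  rw [hc, add_comm (p : ℚ_[p]), h]
  ring

/-- A form of Voronoi's congruence with multiplier `2`. -/
theorem two_pow_sub_one_mul_padicBernoulli_mem (hp : 3 < p) {n h : ℕ} (hn : Even n)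
    (hh : p = 2 * h + 1) :
    (2 ^ n - 1) * (p * padicBernoulli p n) -
      n * p * ∑ j ∈ range h, ((2 * j + 1 : ℕ) : ℚ_[p]) ^ (n - 1) ∈ padicIdeal p 2 := by
  have h1 := sum_range_pow_sub_p_mul_mem hp hn
  have h2 := two_pow_mul_sum_pow (R := ℚ_[p]) n h
  rw [← hh] at h2
  have h3 : ∑ j ∈ range h, (((p : ℚ_[p]) + (2 * j + 1 : ℕ)) ^ n - ((2 * j + 1 : ℕ) : ℚ_[p]) ^ n -
      n * p * ((2 * j + 1 : ℕ) : ℚ_[p]) ^ (n - 1)) ∈ padicIdeal p 2 :=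
    sum_mem fun j _ => add_pow_sub_sub_mem (natCast_mem _) n
  rw [sum_sub_distrib, ← h2, ← mul_sum] at h3
  have h4 : ((2 : ℚ_[p]) ^ n - 1) ∈ padicIdeal p 0 := by
    exact_mod_cast intCast_mem (p := p) (2 ^ n - 1)
  have h5 := sub_mem h3 (int_mul h4 h1)
  refine of_eq h5 ?_
  ring

theorem natCast_pow_add_sub_mem {c : ℕ} (hc : ¬ p ∣ c) (m l : ℕ) :
    (c : ℚ_[p]) ^ (m + (p - 1) * l) - (c : ℚ_[p]) ^ m ∈ padicIdeal p 1 := by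
  have h := pow_sub_one_mem (p := p) (c := ((c ^ l : ℕ) : ℤ_[p]))
    (mt natCast_dvd_iff.1 fun h => hc ((Fact.out : p.Prime).dvd_of_dvd_pow h)) 0
  have := int_mul (int_pow (natCast_mem c) m) h
  refine of_eq this ?_
  push_cast
  rw [pow_zero, one_mul, pow_add, mul_comm (p - 1), pow_mul]
  ring

/-- Eliminating `Q` between the two Voronoi congruences for exponents that are `-3` and `-2`
modulo `p`. -/
theorem mem_of_voronoi (hp : 3 < p) {b b' c c' Q Q' : ℚ_[p]}
    (h1 : (c - 1) * (p * b) - (p - 3) * p * Q ∈ padicIdeal p 2)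
    (h2 : (c' - 1) * (p * b') - ((p - 1) * p ^ 2 - 2) * p * Q' ∈ padicIdeal p 2)
    (hQ : Q' - Q ∈ padicIdeal p 1) (h2N : c' - c ∈ padicIdeal p 1)
    (h2p : c * 2 ^ 2 - 1 ∈ padicIdeal p 1) (hQint : Q ∈ padicIdeal p 0)
    (hb : p * b ∈ padicIdeal p 0) (hb' : p * b' ∈ padicIdeal p 0) :
    3 * b' - 2 * b ∈ padicIdeal p 1 := by
  have hQint' : Q' ∈ padicIdeal p 0 := by
    have hle : padicIdeal p 1 ≤ padicIdeal p 0 := le zero_le_one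
    simpa using add_mem (hle hQ) hQint
  have three : (3 : ℚ_[p]) ∈ padicIdeal p 0 := by exact_mod_cast natCast_mem (p := p) 3
  have two : (2 : ℚ_[p]) ∈ padicIdeal p 0 := by exact_mod_cast natCast_mem (p := p) 2
  have four : (4 : ℚ_[p]) ∈ padicIdeal p 0 := by exact_mod_cast natCast_mem (p := p) 4
  have pint : (p : ℚ_[p]) ∈ padicIdeal p 0 := natCast_mem p
  rw [← p_mul_iff]
  set X := p * (3 * b' - 2 * b) with hX
  have hX0 : X ∈ padicIdeal p 0 := by
    have := sub_mem (int_mul three hb') (int_mul two hb)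
    refine of_eq this ?_
    rw [hX]; ring
  have hpp : (p : ℚ_[p]) * p ∈ padicIdeal p 2 := mul p_mem p_mem
  have pinf : (p : ℚ_[p]) ∈ padicIdeal p 1 := p_mem
  -- A bootstrap, as b and b' may a priori have denominator p. With c ≡ c' ≡ 1/4, the combination
  -- 3·`h2` - 2·`h1` cancels Q and leaves -(3/4)X, up to errors that are multiples of p·X and p·(p
  -- b'). Each pass gains a factor p.
  have key : ∀ m, m ≤ 1 → X ∈ padicIdeal p m → p * b' ∈ padicIdeal p m →
      X ∈ padicIdeal p (m + 1) := by
    intro m hm hXm hbm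
    apply of_natCast_mul (k := 3) (Nat.not_dvd_of_pos_of_lt (by omega) (by omega))
    have hle : padicIdeal p 2 ≤ padicIdeal p (m + 1) := le (by omega)
    have s1 := hle (int_mul three h2)
    have s2 := hle (int_mul two h1)
    have s3 : (2 * p * Q) * p ∈ padicIdeal p (m + 1) := by
      refine hle ?_
      have := int_mul (int_mul two hQint) hpp
      refine of_eq this ?_; ring
    have s4 : (p * p) * ((p - 1) * p * Q' * 3) ∈ padicIdeal p (m + 1) := by
      have h0 : (p - 1) * p * Q' * 3 ∈ padicIdeal p 0 :=
        int_mul (int_mul (int_mul (sub_mem pint (by simpa using natCast_mem (p := p) 1)) pint)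
          hQint') three
      exact hle (mul_int hpp h0)
    have s5 : 6 * (p * (Q' - Q)) ∈ padicIdeal p (m + 1) := by
      have h6 : (6 : ℚ_[p]) ∈ padicIdeal p 0 := by exact_mod_cast natCast_mem (p := p) 6
      have h0 : p * (Q' - Q) ∈ padicIdeal p 2 := mul p_mem hQ
      exact hle (int_mul h6 h0)
    have s6 : 3 * ((p * b') * (c' - c)) ∈ padicIdeal p (m + 1) := int_mul three (mul hbm h2N)
    have s7 : X * (c * 2 ^ 2 - 1) ∈ padicIdeal p (m + 1) := mul hXm h2p
    have tot := sub_mem s7 (int_mul four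
      (sub_mem (add_mem (sub_mem (sub_mem (sub_mem s1 s2) s6) s5) s4) s3))
    refine of_eq tot ?_
    push_cast
    rw [hX]
    ring
  -- Since c' - 1 ≡ -3/4 is a unit, `h2` gives what the second pass of `key` needs.
  have hbone : p * b' ∈ padicIdeal p 1 := by
    apply of_natCast_mul (k := 3) (Nat.not_dvd_of_pos_of_lt (by omega) (by omega))
    have s1 : (p : ℚ_[p]) * (((p - 1) * p ^ 2 - 2) * Q') ∈ padicIdeal p 1 :=
      mul_int pinf (int_mul (sub_mem (int_mul (sub_mem pint (by
        simpa using natCast_mem (p := p) 1)) (int_pow pint 2)) two) hQint')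
    have s2 : (p * b') * (c * 2 ^ 2 - 1) ∈ padicIdeal p 1 := int_mul hb' h2p
    have s3 : (p * b') * (c' - c) ∈ padicIdeal p 1 := int_mul hb' h2N
    have h2' := (le one_le_two : padicIdeal p 2 ≤ padicIdeal p 1) h2
    have tot := add_mem s2 (int_mul four (sub_mem s3 (add_mem h2' s1)))
    refine of_eq tot ?_
    push_cast
    ring
  exact key 1 le_rfl (key 0 (by omega) hX0 hb') hbone

/-- The Kummer congruence `B_{p^2(p-1)-2} / (-2) ≡ B_{p-3} / (-3) (mod p)`. -/
theorem three_mul_padicBernoulli_sub_mem (hp : 3 < p) :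
    3 * padicBernoulli p (p ^ 2 * (p - 1) - 2) - 2 * padicBernoulli p (p - 3) ∈
      padicIdeal p 1 := by
  obtain ⟨h, hh⟩ := (Fact.out : p.Prime).odd_of_ne_two (by omega)
  -- The two exponents differ by a multiple of p - 1, so Fermat identifies the powers mod p.
  have hN : p ^ 2 * (p - 1) - 2 = (p - 3) + (p - 1) * (p ^ 2 - 1) := by
    obtain ⟨q, rfl⟩ : ∃ q, p = q + 3 := ⟨p - 3, by omega⟩
    have : 1 ≤ (q + 3) ^ 2 := Nat.one_le_pow _ _ (by omega)
    obtain ⟨s, hs⟩ : ∃ s, (q + 3) ^ 2 = s + 1 := ⟨(q + 3) ^ 2 - 1, by omega⟩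
    rw [hs, show q + 3 - 1 = q + 2 by omega, show q + 3 - 3 = q by omega,
      show s + 1 - 1 = s by omega, show (s + 1) * (q + 2) = q + (q + 2) * s + 2 by ring,
      Nat.add_sub_cancel]
  set N := p ^ 2 * (p - 1) - 2 with hNdef
  have hN2 : (N : ℚ_[p]) = (p - 1 : ℚ_[p]) * p ^ 2 - 2 := by
    have h1 : N + 2 = p ^ 2 * (p - 1) := by
      have : 5 * 5 * 1 ≤ p ^ 2 * (p - 1) := by
        rw [pow_two]; gcongr <;> omega
      omega
    have h2 := congrArg (fun z : ℕ => (z : ℚ_[p])) h1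
    push_cast [Nat.cast_sub (by omega : 1 ≤ p)] at h2
    linear_combination h2
  have hp3 : ((p - 3 : ℕ) : ℚ_[p]) = p - 3 := by
    push_cast [Nat.cast_sub (by omega : 3 ≤ p)]; ring
  have heven3 : Even (p - 3) := ⟨h - 1, by omega⟩
  have hevenN : Even N := by
    rw [hN]
    exact heven3.add (Even.mul_right ⟨h, by omega⟩ _)
  have h1 := two_pow_sub_one_mul_padicBernoulli_mem hp heven3 hh
  have h2 := two_pow_sub_one_mul_padicBernoulli_mem hp hevenN hh
  have hQ : ∑ j ∈ range h, ((2 * j + 1 : ℕ) : ℚ_[p]) ^ (N - 1) -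
      ∑ j ∈ range h, ((2 * j + 1 : ℕ) : ℚ_[p]) ^ (p - 3 - 1) ∈ padicIdeal p 1 := by
    rw [← sum_sub_distrib]
    refine sum_mem fun j hj => ?_
    have hj := mem_range.1 hj
    rw [show N - 1 = (p - 3 - 1) + (p - 1) * (p ^ 2 - 1) by omega]
    exact natCast_pow_add_sub_mem (c := 2 * j + 1)
      (Nat.not_dvd_of_pos_of_lt (by omega) (by omega)) (p - 3 - 1) (p ^ 2 - 1)
  have h2N := natCast_pow_add_sub_mem (p := p) (c := 2)
    (Nat.not_dvd_of_pos_of_lt (by omega) (by omega)) (p - 3) (p ^ 2 - 1)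
  rw [← hN] at h2N
  have h2p := natCast_pow_add_sub_mem (p := p) (c := 2)
    (Nat.not_dvd_of_pos_of_lt (by omega) (by omega)) 0 1
  rw [show 0 + (p - 1) * 1 = p - 3 + 2 by omega] at h2p
  have hQint : ∑ j ∈ range h, ((2 * j + 1 : ℕ) : ℚ_[p]) ^ (p - 3 - 1) ∈ padicIdeal p 0 :=
    sum_mem fun j _ => int_pow (natCast_mem _) _
  rw [hp3] at h1
  rw [hN2] at h2
  rw [pow_add, pow_zero, Nat.cast_ofNat] at h2p
  rw [Nat.cast_ofNat] at h2N
  exact mem_of_voronoi hp h1 h2 hQ h2N h2p hQint (p_mul_padicBernoulli_mem hp _)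
    (p_mul_padicBernoulli_mem hp _)

end BernoulliCongruences

/-! ### The binomial sum: difference equation and value at `p t`. -/

section BinomialSum

variable {p : ℕ} [Fact p.Prime]

open padicIdeal

/-- The product `∏_{1 ≤ j ≤ k} (1 - x ^ 2 / j ^ 2)`. -/
noncomputable def sineProd (x : ℚ_[p]) (k : ℕ) : ℚ_[p] :=
  ∏ j ∈ range k, (1 - x ^ 2 / ((j : ℚ_[p]) + 1) ^ 2)

/-- The sum of `C(a, k) C(-1 - a, k) / k` over `1 ≤ k ≤ n`. -/
noncomputable def chooseSum (n : ℕ) (a : ℤ_[p]) : ℚ_[p] :=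
  ∑ k ∈ range n, ((Ring.choose a (k + 1) : ℤ_[p]) : ℚ_[p]) *
    ((Ring.choose (-1 - a) (k + 1) : ℤ_[p]) : ℚ_[p]) / ((k : ℚ_[p]) + 1)

theorem natCast_succ_ne_zero (k : ℕ) : (k : ℚ_[p]) + 1 ≠ 0 := by
  exact_mod_cast k.succ_ne_zero

theorem coe_choose_succ (a : ℤ_[p]) (k : ℕ) :
    ((k : ℚ_[p]) + 1) * ((Ring.choose a (k + 1) : ℤ_[p]) : ℚ_[p]) =
      ((Ring.choose a k : ℤ_[p]) : ℚ_[p]) * (a - k) := by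
  have h := Ring.choose_smul_choose a (Nat.le_succ k)
  have h' := congrArg (fun z : ℤ_[p] => (z : ℚ_[p])) h
  simpa [Nat.choose_succ_self_right] using h'

/-- Pairing a - j with -(a + j), the factor of the other binomial one index earlier, gives a product
even in a; only a and a + k + 1 are left over. -/
theorem choose_mul_choose_neg (a : ℤ_[p]) (k : ℕ) :
    ((Ring.choose a (k + 1) : ℤ_[p]) : ℚ_[p]) *
      ((Ring.choose (-1 - a) (k + 1) : ℤ_[p]) : ℚ_[p]) =
      -(a * (a + k + 1)) / ((k : ℚ_[p]) + 1) ^ 2 * sineProd (a : ℚ_[p]) k := by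
  induction k with
  | zero => simp [sineProd]; ring
  | succ k ih =>
    have h1 := coe_choose_succ a (k + 1)
    have h2 := coe_choose_succ (-1 - a) (k + 1)
    have e1 := natCast_succ_ne_zero (p := p) (k + 1)
    have e0 := natCast_succ_ne_zero (p := p) k
    rw [← mul_right_inj' (pow_ne_zero 2 e1)]
    have h3 : (((k + 1 : ℕ) : ℚ_[p]) + 1) ^ 2 *
        (((Ring.choose a (k + 1 + 1) : ℤ_[p]) : ℚ_[p]) *
        ((Ring.choose (-1 - a) (k + 1 + 1) : ℤ_[p]) : ℚ_[p])) =
        (((Ring.choose a (k + 1) : ℤ_[p]) : ℚ_[p]) *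
        ((Ring.choose (-1 - a) (k + 1) : ℤ_[p]) : ℚ_[p])) *
        ((a - (k + 1 : ℕ)) * (((-1 - a : ℤ_[p]) : ℚ_[p]) - (k + 1 : ℕ))) := by
      linear_combination (((k + 1 : ℕ) : ℚ_[p]) + 1) *
        ((Ring.choose (-1 - a) (k + 1 + 1) : ℤ_[p]) : ℚ_[p]) * h1 +
        ((Ring.choose a (k + 1) : ℤ_[p]) : ℚ_[p]) * (a - (k + 1 : ℕ)) * h2
    rw [h3, ih, sineProd, sineProd, prod_range_succ]
    push_cast at e1 ⊢
    field_simp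
    ring

theorem chooseSum_eq (n : ℕ) (a : ℤ_[p]) :
    chooseSum n a = ∑ k ∈ range n,
      -(a * (a + k + 1)) / ((k : ℚ_[p]) + 1) ^ 3 * sineProd (a : ℚ_[p]) k := by
  refine sum_congr rfl fun k _ => ?_
  rw [choose_mul_choose_neg]
  have e0 := natCast_succ_ne_zero (p := p) k
  field_simp

theorem chooseSum_sub_one (n : ℕ) (a : ℤ_[p]) : chooseSum n (a - 1) = chooseSum n (-a) := by
  refine sum_congr rfl fun k _ => ?_
  rw [show -1 - (a - 1) = -a by ring, show -1 - -a = a - 1 by ring, mul_comm]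

theorem sineProd_neg (x : ℚ_[p]) (k : ℕ) : sineProd (-x) k = sineProd x k := by
  simp [sineProd]

/-- By reflection S(a-1) = S(-a). As `sineProd` is even, only the odd part of a(a+k+1) survives, and
a times each difference is twice an increment of `sineProd`. -/
theorem mul_chooseSum_sub (n : ℕ) (a : ℤ_[p]) :
    (a : ℚ_[p]) * (chooseSum n a - chooseSum n (a - 1)) = 2 * (sineProd (a : ℚ_[p]) n - 1) := by
  rw [chooseSum_sub_one, chooseSum_eq, chooseSum_eq]
  induction n with
  | zero => simp [sineProd]
  | succ n ih =>
    have e0 := natCast_succ_ne_zero (p := p) n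
    have hs : sineProd (a : ℚ_[p]) (n + 1) =
        sineProd (a : ℚ_[p]) n * (1 - (a : ℚ_[p]) ^ 2 / ((n : ℚ_[p]) + 1) ^ 2) :=
      prod_range_succ _ _
    rw [sum_range_succ, sum_range_succ, hs]
    simp only [PadicInt.coe_neg, sineProd_neg] at ih ⊢
    have : (a : ℚ_[p]) * (-(a * (a + n + 1)) / ((n : ℚ_[p]) + 1) ^ 3 * sineProd (a : ℚ_[p]) n -
        -(-a * (-a + n + 1)) / ((n : ℚ_[p]) + 1) ^ 3 * sineProd (a : ℚ_[p]) n) =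
        2 * (sineProd (a : ℚ_[p]) n * (1 - (a : ℚ_[p]) ^ 2 / ((n : ℚ_[p]) + 1) ^ 2)) -
        2 * sineProd (a : ℚ_[p]) n := by
      field_simp
      ring
    linear_combination ih + this

theorem prod_erase_sub_eq_neg_one {i : ℕ} (hi : i < p) :
    ∏ j ∈ (range p).erase i, ((j : ZMod p) - i) = -1 := by
  have h0 : ∏ j ∈ (range p).erase i, ((j : ZMod p) - i) =
      ∏ j ∈ (range p).erase 0, (j : ZMod p) := by
    refine prod_nbij' (fun j => ((j : ZMod p) - (i : ZMod p)).val)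
      (fun j => ((j : ZMod p) + (i : ZMod p)).val)
      ?_ ?_ ?_ ?_ ?_
    · intro j hj
      rw [mem_erase, mem_range] at hj
      rw [mem_erase, mem_range]
      refine ⟨fun h => hj.1 ?_, ZMod.val_lt _⟩
      rw [ZMod.val_eq_zero, sub_eq_zero] at h
      have := congrArg ZMod.val h
      rwa [ZMod.val_cast_of_lt hj.2, ZMod.val_cast_of_lt hi] at this
    · intro j hj
      rw [mem_erase, mem_range] at hj
      rw [mem_erase, mem_range]
      refine ⟨fun h => hj.1 ?_, ZMod.val_lt _⟩
      have h' : (j : ZMod p) + (i : ZMod p) = i := by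
        rw [← ZMod.natCast_zmod_val ((j : ZMod p) + (i : ZMod p)), h]
      have := congrArg ZMod.val (add_eq_right.1 h')
      rwa [ZMod.val_cast_of_lt hj.2, ZMod.val_zero] at this
    · intro j hj
      rw [mem_erase, mem_range] at hj
      simp [ZMod.val_cast_of_lt hj.2]
    · intro j hj
      rw [mem_erase, mem_range] at hj
      simp [ZMod.val_cast_of_lt hj.2]
    · intro j _
      simp
  have h1 : (range p).erase 0 = (range (p - 1)).image (· + 1) := by
    ext j
    simp only [mem_erase, mem_range, mem_image]
    constructor
    · rintro ⟨h, h'⟩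
      exact ⟨j - 1, by omega, by omega⟩
    · rintro ⟨l, hl, rfl⟩
      omega
  rw [h0, h1, prod_image (by simp), ← ZMod.wilsons_lemma p, ← prod_range_add_one_eq_factorial]
  push_cast
  rfl

/-- Among the j - x with 0 ≤ j < p only i - x is a non-unit, and it is kept exactly; the others
multiply to -1 mod p by Wilson. A relative error of p suffices because two such products get
multiplied. -/
theorem mul_prod_sub_eq {x : ℤ_[p]} {i : ℕ} (hi : i < p) (hx : (p : ℤ_[p]) ∣ x - i) :
    ∃ e ∈ padicIdeal p 1, (x : ℚ_[p]) * ∏ j ∈ range (p - 1), ((j : ℚ_[p]) + 1 - x) =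
      (i - x) * (1 + e) := by
  have hz : PadicInt.toZMod x = (i : ZMod p) := by
    rw [← sub_eq_zero, ← map_natCast (PadicInt.toZMod (p := p)), ← map_sub, ← RingHom.mem_ker,
      PadicInt.ker_toZMod, PadicInt.maximalIdeal_eq_span_p, Ideal.mem_span_singleton]
    exact hx
  have hU : (p : ℤ_[p]) ^ 1 ∣ ∏ j ∈ (range p).erase i, ((j : ℤ_[p]) - x) + 1 := by
    rw [pow_one, ← Ideal.mem_span_singleton, ← PadicInt.maximalIdeal_eq_span_p, ← PadicInt.ker_toZMod,
      RingHom.mem_ker, map_add, map_prod, map_one]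
    simp only [map_sub, map_natCast, hz]
    rw [prod_erase_sub_eq_neg_one hi, neg_add_cancel]
  refine ⟨_, neg_mem (coe_mem_iff.2 hU), ?_⟩
  have h1 := mul_prod_erase (range p) (fun j : ℕ => (j : ℤ_[p]) - x) (mem_range.2 hi)
  have h2 : ∏ j ∈ range p, ((j : ℤ_[p]) - x) =
      -(x * ∏ j ∈ range (p - 1), ((j : ℤ_[p]) + 1 - x)) := by
    have : range p = range (p - 1 + 1) := by
      rw [Nat.sub_add_cancel (Fact.out : p.Prime).one_le]
    rw [this, prod_range_succ']
    push_cast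
    ring
  rw [h2] at h1
  have h3 := congrArg (fun z : ℤ_[p] => (z : ℚ_[p])) h1
  have h4 : ((∏ j ∈ range (p - 1), ((j : ℤ_[p]) + 1 - x) : ℤ_[p]) : ℚ_[p]) =
      ∏ j ∈ range (p - 1), ((j : ℚ_[p]) + 1 - x) := by
    refine (map_prod (PadicInt.Coe.ringHom (p := p)) _ _).trans (prod_congr rfl fun j _ => ?_)
    change (((j : ℤ_[p]) + 1 - x : ℤ_[p]) : ℚ_[p]) = _
    push_cast
    rfl
  rw [← h4]
  push_cast at h3 ⊢
  linear_combination h3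

theorem factorial_sq_sub_one_mem : (((p - 1).factorial : ℚ_[p])) ^ 2 - 1 ∈ padicIdeal p 1 := by
  have h : (p : ℤ_[p]) ^ 1 ∣ ((p - 1).factorial : ℤ_[p]) ^ 2 - 1 := by
    rw [pow_one, ← Ideal.mem_span_singleton, ← PadicInt.maximalIdeal_eq_span_p,
      ← PadicInt.ker_toZMod, RingHom.mem_ker, map_sub, map_pow, map_natCast, map_one,
      ZMod.wilsons_lemma]
    ring
  have := coe_mem_iff.2 h
  push_cast at this
  exact this

theorem factorial_sq_mul_sineProd (x : ℚ_[p]) (n : ℕ) :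
    (n.factorial : ℚ_[p]) ^ 2 * sineProd x n =
      (∏ j ∈ range n, ((j : ℚ_[p]) + 1 - x)) * ∏ j ∈ range n, ((j : ℚ_[p]) + 1 + x) := by
  rw [← prod_range_add_one_eq_factorial, sineProd, ← prod_mul_distrib]
  push_cast
  rw [← prod_pow, ← prod_mul_distrib]
  refine prod_congr rfl fun j _ => ?_
  have e0 := natCast_succ_ne_zero (p := p) j
  field_simp
  ring

/-- For a unit `a = p t + i` the product `a ^ 2 ∏ (1 - a ^ 2 / j ^ 2)` is `p ^ 2 t (t + 1)`
modulo `p ^ 3`. -/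
theorem sq_mul_sineProd_mem {a t : ℤ_[p]} {i : ℕ} (h0 : 0 < i) (hi : i < p)
    (ha : a = p * t + i) :
    (a : ℚ_[p]) ^ 2 * sineProd (a : ℚ_[p]) (p - 1) - p ^ 2 * ((t : ℚ_[p]) * ((t : ℚ_[p]) + 1)) ∈
      padicIdeal p 3 := by
  obtain ⟨e, he, h1⟩ := mul_prod_sub_eq (x := a) hi ⟨t, by rw [ha]; ring⟩
  -- -a has residue p - i, so the two exceptional factors are -pt and p(t+1).
  obtain ⟨e', he', h2⟩ := mul_prod_sub_eq (x := -a) (i := p - i) (by omega)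
    ⟨-t - 1, by rw [ha, Nat.cast_sub hi.le]; ring⟩
  have hm := factorial_sq_sub_one_mem (p := p)
  have h3 := factorial_sq_mul_sineProd (a : ℚ_[p]) (p - 1)
  have hdvd : ¬ p ∣ ((p - 1).factorial) ^ 2 := by
    intro h
    have h' := (Fact.out : p.Prime).dvd_of_dvd_pow h
    rw [(Fact.out : p.Prime).dvd_factorial] at h'
    omega
  have haq : (a : ℚ_[p]) = p * t + i := by rw [ha]; push_cast; rfl
  replace h2 : -(a : ℚ_[p]) * ∏ j ∈ range (p - 1), ((j : ℚ_[p]) + 1 + a) =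
      (p - i + a) * (1 + e') := by
    simpa [Nat.cast_sub hi.le] using h2
  apply of_natCast_mul hdvd
  have one : (1 : ℚ_[p]) ∈ padicIdeal p 0 := by simpa using natCast_mem (p := p) 1
  have hee : e * e' ∈ padicIdeal p 1 := le (by omega) (mul he he')
  have hdiff := sub_mem (add_mem (add_mem he he') hee) hm
  have ht : (t : ℚ_[p]) * (t + 1) ∈ padicIdeal p 0 :=
    int_mul (coe_mem t) (add_mem (coe_mem t) one)
  have tot := mul (mul_int (pow_mem (p := p) 2) ht) hdiff
  refine of_eq tot ?_
  push_cast
  have e1 : (i : ℚ_[p]) - a = -(p * t) := by rw [haq]; ring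
  have e2 : (p : ℚ_[p]) - i + a = p * (t + 1) := by rw [haq]; ring
  rw [e1] at h1
  rw [e2] at h2
  have h12 : _ * _ = _ * _ := congrArg₂ (· * ·) h1 h2
  linear_combination (a : ℚ_[p]) ^ 2 * h3 - h12

theorem not_dvd_p_mul_add {t : ℤ_[p]} {i : ℕ} (h0 : 0 < i) (hi : i < p) :
    ¬ (p : ℤ_[p]) ∣ p * t + i := by
  rw [dvd_add_right (dvd_mul_right _ _), natCast_dvd_iff]
  exact Nat.not_dvd_of_pos_of_lt h0 hi

theorem pow_pred_sub_inv_mem {c : ℤ_[p]} (hc : ¬ (p : ℤ_[p]) ∣ c) (k : ℕ) {m l : ℕ}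
    (hml : m + l = p ^ k * (p - 1)) :
    (c : ℚ_[p]) ^ m - ((c : ℚ_[p]) ^ l)⁻¹ ∈ padicIdeal p (k + 1) := by
  have hc0 : (c : ℚ_[p]) ≠ 0 := by
    intro h
    apply hc
    rw [PadicInt.coe_eq_zero.1 h]
    exact dvd_zero _
  have h := int_mul (int_pow (inv_mem hc) l) (pow_sub_one_mem hc k)
  refine of_eq h ?_
  have hl : (c : ℚ_[p]) ^ l ≠ 0 := pow_ne_zero l hc0
  rw [← hml, pow_add, inv_pow]
  field_simp

theorem chooseSum_step_mem (hp : 3 < p) {a t : ℤ_[p]} {i : ℕ} (h0 : 0 < i) (hi : i < p)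
    (ha : a = p * t + i) :
    chooseSum (p - 1) a - chooseSum (p - 1) (a - 1) + 2 * (a : ℚ_[p]) ^ (p ^ 2 * (p - 1) - 1) -
      2 * (p : ℚ_[p]) ^ 2 * ((t : ℚ_[p]) * ((t : ℚ_[p]) + 1)) * (a : ℚ_[p]) ^ (p - 4) ∈
      padicIdeal p 3 := by
  have hna : ¬ (p : ℤ_[p]) ∣ a := ha ▸ not_dvd_p_mul_add h0 hi
  have hM : 1 ≤ p ^ 2 * (p - 1) := Nat.mul_pos (pow_pos (by omega) 2) (by omega)
  have h1 := mul_chooseSum_sub (p - 1) a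
  have h2 := sq_mul_sineProd_mem h0 hi ha
  have h3 := pow_pred_sub_inv_mem hna 2 (m := p ^ 2 * (p - 1) - 1) (l := 1) (by omega)
  -- Precision p is enough, since a⁻³ carries the factor p².
  have h4 := pow_pred_sub_inv_mem hna 0 (m := p - 4) (l := 3) (by rw [pow_zero]; omega)
  have hc0 : (a : ℚ_[p]) ≠ 0 := by
    intro h
    apply hna
    rw [PadicInt.coe_eq_zero.1 h]
    exact dvd_zero _
  have two : (2 : ℚ_[p]) ∈ padicIdeal p 0 := by exact_mod_cast natCast_mem (p := p) 2
  have one : (1 : ℚ_[p]) ∈ padicIdeal p 0 := by simpa using natCast_mem (p := p) 1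
  have ht : (t : ℚ_[p]) * (t + 1) ∈ padicIdeal p 0 :=
    int_mul (coe_mem t) (add_mem (coe_mem t) one)
  have s1 := int_mul (int_mul two (int_pow (inv_mem hna) 3)) h2
  have s2 := int_mul two h3
  have s3 := mul (mul_int (int_mul two (pow_mem (p := p) 2)) ht) h4
  refine of_eq (sub_mem (add_mem s1 s2) s3) ?_
  have h5 : chooseSum (p - 1) a - chooseSum (p - 1) (a - 1) =
      (a : ℚ_[p])⁻¹ * (2 * (sineProd (a : ℚ_[p]) (p - 1) - 1)) := by
    rw [← h1, inv_mul_cancel_left₀ hc0]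
  rw [h5]
  field_simp
  ring

theorem chooseSum_add_natCast_mem (hp : 3 < p) (t : ℤ_[p]) (r : ℕ) (hr : r < p) :
    chooseSum (p - 1) ((p : ℤ_[p]) * t + (r : ℤ_[p])) - chooseSum (p - 1) ((p : ℤ_[p]) * t) +
      2 * ∑ i ∈ range r, ((p : ℚ_[p]) * t + (i + 1 : ℕ)) ^ (p ^ 2 * (p - 1) - 1) -
      2 * (p : ℚ_[p]) ^ 2 * ((t : ℚ_[p]) * ((t : ℚ_[p]) + 1)) *
        ∑ i ∈ range r, ((p : ℚ_[p]) * t + (i + 1 : ℕ)) ^ (p - 4) ∈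
      padicIdeal p 3 := by
  induction r with
  | zero => simp
  | succ r ih =>
    have h1 := ih (by omega)
    have h2 := chooseSum_step_mem hp (a := (p : ℤ_[p]) * t + (r + 1 : ℕ)) r.succ_pos hr rfl
    rw [show (p : ℤ_[p]) * t + (r + 1 : ℕ) - 1 = p * t + r by push_cast; ring] at h2
    refine of_eq (add_mem h1 h2) ?_
    rw [sum_range_succ, sum_range_succ]
    simp only [PadicInt.coe_add, PadicInt.coe_mul, PadicInt.coe_natCast]
    ring

/-- The terms for k and p - k cancel mod p because the exponent is odd. -/
theorem sum_inv_cube_mem (hp : 3 < p) :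
    ∑ k ∈ range (p - 1), (((k : ℚ_[p]) + 1)⁻¹) ^ 3 ∈ padicIdeal p 1 := by
  apply of_natCast_mul (k := 2) (Nat.not_dvd_of_pos_of_lt (by omega) (by omega))
  have hr := sum_range_reflect (fun k : ℕ => (((k : ℚ_[p]) + 1)⁻¹) ^ 3) (p - 1)
  rw [Nat.cast_ofNat, two_mul]
  nth_rewrite 1 [← hr]
  rw [← sum_add_distrib]
  refine sum_mem fun k hk => ?_
  have hk := mem_range.1 hk
  have u := natCast_succ_inv_mem (p := p) hk
  have v := natCast_succ_inv_mem (p := p) (k := p - 1 - 1 - k) (by omega)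
  have hv : ((p - 1 - 1 - k : ℕ) : ℚ_[p]) + 1 = p - (k + 1) := by
    rw [eq_sub_iff_add_eq]
    exact_mod_cast (by omega : p - 1 - 1 - k + 1 + (k + 1) = p)
  have e0 := natCast_succ_ne_zero (p := p) k
  have e1 := natCast_succ_ne_zero (p := p) (p - 1 - 1 - k)
  rw [hv] at e1 v ⊢
  have hx : (p : ℚ_[p]) ^ 2 - ((3 * (k + 1) : ℕ) : ℚ_[p]) * p + ((3 * (k + 1) ^ 2 : ℕ) : ℚ_[p]) ∈
      padicIdeal p 0 :=
    add_mem (sub_mem (int_pow (natCast_mem _) _) (int_mul (natCast_mem _) (natCast_mem _)))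
      (natCast_mem _)
  refine of_eq (mul_int (mul_int (mul_int p_mem hx) (int_pow u 3)) (int_pow v 3)) ?_
  push_cast
  field_simp
  ring

theorem sineProd_sub_one_mem {x : ℚ_[p]} (hx : x ∈ padicIdeal p 1) {k : ℕ} (hk : k < p) :
    sineProd x k - 1 ∈ padicIdeal p 2 := by
  induction k with
  | zero => simp [sineProd]
  | succ k ih =>
    have u := natCast_succ_inv_mem (p := p) (k := k) (by omega)
    have h1 := ih (by omega)
    have h2 : x * x * (((k : ℚ_[p]) + 1)⁻¹) ^ 2 ∈ padicIdeal p 2 :=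
      mul_int (mul hx hx) (int_pow u 2)
    have h3 := int_mul (le (Nat.zero_le 2) h1) h2
    refine of_eq (sub_mem h1 (add_mem h2 h3)) ?_
    rw [sineProd, prod_range_succ, ← sineProd, div_eq_mul_inv, ← inv_pow]
    ring

theorem sum_range_pow_eq_sum_succ {N : ℕ} (hN : N ≠ 0) :
    ∑ j ∈ range p, (j : ℚ_[p]) ^ N = ∑ k ∈ range (p - 1), ((k : ℚ_[p]) + 1) ^ N := by
  have : range p = range (p - 1 + 1) := by
    rw [Nat.sub_add_cancel (Fact.out : p.Prime).one_le]
  rw [this, sum_range_succ']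
  simp [hN]

/-- At x = pt the products are 1 + O(p²), so the sum is -x∑k⁻² - x²∑k⁻³ mod p³. The cubes drop out
by `sum_inv_cube_mem`, and Euler turns k⁻² into a positive power. -/
theorem chooseSum_p_mul_mem (hp : 3 < p) (t : ℤ_[p]) :
    chooseSum (p - 1) ((p : ℤ_[p]) * t) +
        (p : ℚ_[p]) * t * ∑ j ∈ range p, (j : ℚ_[p]) ^ (p ^ 2 * (p - 1) - 2) ∈
      padicIdeal p 3 := by
  have hM : 3 ≤ p ^ 2 * (p - 1) := by
    have : 1 ≤ p ^ 2 := Nat.one_le_pow _ _ (by omega)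
    nlinarith [Nat.sub_add_cancel (by omega : 1 ≤ p)]
  have hx : (p : ℚ_[p]) * t ∈ padicIdeal p 1 := mul_int p_mem (coe_mem t)
  have one : (1 : ℚ_[p]) ∈ padicIdeal p 0 := by simpa using natCast_mem (p := p) 1
  have h3 : ((p : ℚ_[p]) * t) * (p * t) * ∑ k ∈ range (p - 1), (((k : ℚ_[p]) + 1)⁻¹) ^ 3 ∈
      padicIdeal p 3 := mul (mul hx hx) (sum_inv_cube_mem hp)
  rw [chooseSum_eq, sum_range_pow_eq_sum_succ (by omega), mul_sum, ← sum_add_distrib]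
  rw [mul_sum] at h3
  rw [← add_mem_cancel_right h3, ← sum_add_distrib]
  refine sum_mem fun k hk => ?_
  have hk := mem_range.1 hk
  have u := natCast_succ_inv_mem (p := p) hk
  have h1 := sineProd_sub_one_mem hx (k := k) (by omega)
  have h2 := pow_pred_sub_inv_mem (p := p) (c := ((k + 1 : ℕ) : ℤ_[p]))
    (mt natCast_dvd_iff.1 (Nat.not_dvd_of_pos_of_lt (by omega) (by omega))) 2
    (m := p ^ 2 * (p - 1) - 2) (l := 2) (by omega)
  have s1 := int_mul (le (Nat.zero_le 1) hx) h2
  have s2 : ((p : ℚ_[p]) * (t : ℚ_[p])) *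
      (((p : ℚ_[p]) * (t : ℚ_[p]) + k + 1) * (((k : ℚ_[p]) + 1)⁻¹) ^ 3) *
      (sineProd ((p : ℚ_[p]) * (t : ℚ_[p])) k - 1) ∈ padicIdeal p 3 :=
    mul (mul_int hx (int_mul (add_mem (add_mem (le (Nat.zero_le 1) hx) (natCast_mem k)) one)
      (int_pow u 3))) h1
  refine of_eq (sub_mem s1 s2) ?_
  have e0 := natCast_succ_ne_zero (p := p) k
  push_cast
  field_simp
  ring

end BinomialSum

/-! ### Combining the expansions. -/

section Assembly

variable {p : ℕ} [Fact p.Prime]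

open padicIdeal

/-- The final elimination of the auxiliary quantities: `F₁`, `F₀` stand for the binomial sums at
`p s + r` and `p s`, `A` and `C` for power sums, `S` for a power sum close to `p b'`, and
`β`, `γ` for values of Bernoulli polynomials at `p s`. -/
theorem mem_of_expansions (hp : 3 < p) {s A C F₁ F₀ S b b' β γ bM x y : ℚ_[p]}
    (hs : s ∈ padicIdeal p 0) (hC : C ∈ padicIdeal p 0)
    (hx : x ∈ padicIdeal p 3) (hy : y ∈ padicIdeal p 1) (hb' : p * b' ∈ padicIdeal p 0)
    (h1 : F₁ - F₀ + 2 * A - 2 * (p : ℚ_[p]) ^ 2 * (s * (s + 1)) * C ∈ padicIdeal p 3)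
    (h2 : F₀ + p * s * S ∈ padicIdeal p 3) (h3 : S - p * b' ∈ padicIdeal p 2)
    (h4 : 3 * b' - 2 * b ∈ padicIdeal p 1) (h5 : β - b ∈ padicIdeal p 1)
    (h6 : (γ - bM) / (p ^ 2 * (p - 1)) -
      ((p : ℚ_[p]) ^ 2 * (p - 1) - 1) / 2 * b' * (p * s) ^ 2 ∈ padicIdeal p 3) :
    F₁ - (-(2 / 3 : ℚ_[p]) * (p : ℚ_[p]) ^ 2 * s * (s + 1) * (β + (p - 3) * y + (p - 3) * C) -
      2 * ((γ + p ^ 2 * (p - 1) * x + p ^ 2 * (p - 1) * A - bM) / (p ^ 2 * (p - 1)))) ∈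
      padicIdeal p 3 := by
  have hp0 := p_ne_zero (p := p)
  have hp1 : (p : ℚ_[p]) - 1 ≠ 0 := by
    rw [sub_ne_zero]
    exact_mod_cast (by omega : p ≠ 1)
  have nat : ∀ n : ℕ, (n : ℚ_[p]) ∈ padicIdeal p 0 := natCast_mem
  have one : (1 : ℚ_[p]) ∈ padicIdeal p 0 := by simpa using natCast_mem (p := p) 1
  apply of_natCast_mul (k := 3) (Nat.not_dvd_of_pos_of_lt (by omega) hp)
  have hss : (p : ℚ_[p]) ^ 2 * (s * (s + 1)) ∈ padicIdeal p 2 :=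
    mul_int (pow_mem 2) (int_mul hs (add_mem hs one))
  have t1 := int_mul (nat 3) (add_mem h1 h2)
  have t2 : ((3 : ℕ) : ℚ_[p]) * ((p * s) * (S - p * b')) ∈ padicIdeal p 3 :=
    int_mul (nat 3) (mul (mul_int p_mem hs) h3)
  -- With the contribution of `h6`, the b' terms combine to -p²s(s+1)b', which `h4` converts into b;
  -- the leftover multiple of p⁴b' is `t6`.
  have t3 := int_mul (nat 6) (add_mem h6 hx)
  have t4 := mul hss h4
  have t5 : (p : ℚ_[p]) ^ 2 * (s * (s + 1)) * ((β - b) + (p - (3 : ℕ)) * y + p * C) ∈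
      padicIdeal p 3 := by
    refine mul hss (add_mem (add_mem h5 (int_mul ?_ hy)) (mul_int p_mem hC))
    exact sub_mem (nat p) (nat 3)
  have t6 : ((3 : ℕ) : ℚ_[p]) * ((p : ℚ_[p]) ^ 3 * ((p - 1) * s ^ 2 * (p * b'))) ∈
      padicIdeal p 3 := by
    refine int_mul (nat 3) (mul_int (pow_mem 3) (int_mul (int_mul ?_ (int_pow hs 2)) hb'))
    exact sub_mem (nat p) one
  have t5' := int_mul (nat 2) t5
  refine of_eq (add_mem (add_mem (sub_mem (add_mem (sub_mem t1 t2) t3) t4) t5') t6) ?_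
  push_cast
  field_simp
  ring

end Assembly

open padicIdeal in
theorem theorem5p1 (p : ℕ) [Fact p.Prime] (hp : 3 < p) (a : ℤ_[p])
    (ha : ¬ (p : ℤ_[p]) ∣ a) (t : ℚ_[p])
    (ht : t = ((a : ℚ_[p]) - (a.zmodRepr : ℚ_[p])) / (p : ℚ_[p])) :
    PadicModEq p 3
      (∑ k ∈ Finset.Icc 1 (p - 1),
        ((Ring.choose a k : ℤ_[p]) : ℚ_[p]) * ((Ring.choose (-1 - a) k : ℤ_[p]) : ℚ_[p])
          / (k : ℚ_[p]))
      (-(2 / 3 : ℚ_[p]) * (p : ℚ_[p]) ^ 2 * t * (t + 1)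
          * bernoulliPolyVal p (p - 3) (-(a : ℚ_[p]))
        - 2 * ((bernoulliPolyVal p (p ^ 2 * (p - 1)) (-(a : ℚ_[p]))
              - ((bernoulli (p ^ 2 * (p - 1)) : ℚ) : ℚ_[p]))
            / ((p : ℚ_[p]) ^ 2 * ((p : ℚ_[p]) - 1)))) := by
  obtain ⟨r, hr⟩ : ∃ r, a.zmodRepr = r := ⟨_, rfl⟩
  have hrp : r < p := hr ▸ a.zmodRepr_lt_p
  obtain ⟨s, hs⟩ : (p : ℤ_[p]) ∣ a - r := by
    rw [← hr, ← Ideal.mem_span_singleton, ← PadicInt.maximalIdeal_eq_span_p]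
    exact a.sub_zmodRepr_mem
  have has : a = p * s + r := by rw [← hs]; ring
  have hp0 := p_ne_zero (p := p)
  have haq : (a : ℚ_[p]) = p * s + r := by
    have := congrArg (fun z : ℤ_[p] => (z : ℚ_[p])) has
    simpa using this
  have hts : t = s := by
    rw [ht, hr, haq]
    field_simp
    ring
  have hsum : ∑ k ∈ Finset.Icc 1 (p - 1),
        ((Ring.choose a k : ℤ_[p]) : ℚ_[p]) * ((Ring.choose (-1 - a) k : ℤ_[p]) : ℚ_[p])
          / (k : ℚ_[p]) = chooseSum (p - 1) ((p : ℤ_[p]) * s + (r : ℤ_[p])) := by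
    rw [← has, chooseSum, ← Finset.Ico_add_one_right_eq_Icc, sum_Ico_eq_sum_range]
    refine sum_congr (by simp) fun k _ => ?_
    rw [add_comm 1 k]
    push_cast
    rfl
  obtain ⟨h, hh⟩ := (Fact.out : p.Prime).odd_of_ne_two (by omega)
  have heven3 : Even (p - 3) := ⟨h - 1, by omega⟩
  have hevenM : Even (p ^ 2 * (p - 1)) := Even.mul_left ⟨h, by omega⟩ _
  have hM : 100 ≤ p ^ 2 * (p - 1) := by
    have : 5 ≤ p := by
      rcases Nat.lt_or_ge p 5 with h5 | h5
      · omega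
      · exact h5
    calc 100 = 5 ^ 2 * 4 := by norm_num
      _ ≤ p ^ 2 * (p - 1) := by gcongr; omega
  have hMcast : ((p ^ 2 * (p - 1) : ℕ) : ℚ_[p]) = p ^ 2 * (p - 1) := by
    push_cast [Nat.cast_sub (by omega : 1 ≤ p)]
    ring
  have h1 := chooseSum_add_natCast_mem hp s r hrp
  have h2 := chooseSum_p_mul_mem hp s
  have h3 := sum_range_pow_sub_p_mul_mem hp (n := p ^ 2 * (p - 1) - 2)
    (hevenM.tsub even_two)
  have h4 := three_mul_padicBernoulli_sub_mem hp
  have h5 := bernoulliPolyVal_p_mul_sub_mem hp heven3 (coe_mem s)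
  have h6 := bernoulliPolyVal_p_mul_sub_div_mem hp hevenM (by omega) (coe_mem s)
  have h7 := bernoulliPolyVal_neg_add_natCast heven3 r ((p : ℚ_[p]) * (s : ℚ_[p]))
  have h8 := bernoulliPolyVal_neg_add_natCast hevenM r ((p : ℚ_[p]) * (s : ℚ_[p]))
  have hb' := p_mul_padicBernoulli_mem hp (p ^ 2 * (p - 1) - 2)
  have hx : (p : ℚ_[p]) * s ∈ padicIdeal p 1 := mul_int p_mem (coe_mem s)
  -- The powers of ps produced by reflection are negligible; for the second, p - 4 ≥ 1 suffices.
  have hxM : ((p : ℚ_[p]) * (s : ℚ_[p])) ^ (p ^ 2 * (p - 1) - 1) ∈ padicIdeal p 3 := by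
    rw [mul_pow]
    exact mul_int (le (by omega) (pow_mem _)) (int_pow (coe_mem s) _)
  have hx3 : ((p : ℚ_[p]) * (s : ℚ_[p])) ^ (p - 3 - 1) ∈ padicIdeal p 1 := by
    rw [mul_pow]
    exact mul_int (le (by omega) (pow_mem _)) (int_pow (coe_mem s) _)
  have hCint : ∑ i ∈ range r, ((p : ℚ_[p]) * (s : ℚ_[p]) + (i + 1 : ℕ)) ^ (p - 3 - 1) ∈ padicIdeal p 0 :=
    sum_mem fun i _ => int_pow (add_mem (le (Nat.zero_le 1) hx) (natCast_mem _)) _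
  rw [show p - 4 = p - 3 - 1 by omega] at h1
  rw [hMcast] at h6 h8
  rw [show ((p - 3 : ℕ) : ℚ_[p]) = p - 3 by push_cast [Nat.cast_sub (by omega : 3 ≤ p)]; ring] at h7
  rw [padicModEq_iff, hsum, hts, haq, h7, h8, ← padicBernoulli]
  exact mem_of_expansions hp (coe_mem s) hCint hxM hx3 hb' h1 h2 h3 h4 h5 h6
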